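/- A bar-partition of $n$ is a partition of $n$ into distinct positive parts. If $x$ is a part of a bar-partition $\lambda$, the lengths of the bars of $\lambda$ in the row of $x$ are the elements of $$\bigl(\{1,\dots,x\}\cup\{x+y : y\in\lambda,\ y<x\}\bigr)\setminus\{x-y : y\in\lambda,\ y<x\}.$$ Removing the bar of length $b$ in this row means replacing the part $x$ by $x-b$ if $b<x$, deleting $x$ if $b=x$, and deleting the two parts $x$ and $y$ if $b=x+y>x$. For an odd integer $\ell\ge 1$, an $\bar\ell$-core is a bar-partition with no bar of length divisible by $\ell$. The $\bar\ell$-core of a bar-partition $\lambda$ is the $\bar\ell$-core obtained from $\lambda$ by successively removing bars of length divisible by $\ell$ until none is left. An $\bar\ell$-block of bar-partitions of $n$ is the set of all bar-partitions of $n$ with a common given $\bar\ell$-core, and the principal $\bar\ell$-block of $n$ is the one that contains the bar-partition $(n)$. **Corollary.** Let $r$, $s$ and $t$ be positive integers such that $s$ and $t$ are odd and $s>r\ge t$, and let $n=as+r$ for some $a\in\mathbb{Z}_{\ge 0}$. Then the principal $\bar s$-block of $n$ contains no $\bar t$-core. -/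

import Mathlib

/-- A bar-partition: a partition with distinct parts, given by the finite set of its
(positive) parts. -/
@[ext]
structure BarPartition where
  parts : Finset ℕ
  pos : ∀ x ∈ parts, 0 < x

namespace BarPartition

/-- The integer that is partitioned. -/
def size (μ : BarPartition) : ℕ := ∑ x ∈ μ.parts, x

/-- The bar-partition `(n)` with a single part `n`; for `n = 0` this is the empty partition. -/
def single (n : ℕ) : BarPartition where
  parts := ({n} : Finset ℕ).erase 0
  pos := fun _ hx => Nat.pos_of_ne_zero (Finset.ne_of_mem_erase hx)

/-- The lengths of the bars attached to the nodes in the row of the part `x` of `μ` in the shifted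
Young diagram: `({1, …, x} ∪ {x + y : y}) \ {x - y : y}`, where `y` runs through the parts
of `μ` smaller than `x`. There are exactly `x` of them, and listed in decreasing order they are the
bar-lengths of the successive nodes of the row. -/
def barLengths (μ : BarPartition) (x : ℕ) : Finset ℕ :=
  (Finset.Icc 1 x ∪ (μ.parts.filter (· < x)).image (fun y => x + y)) \
    (μ.parts.filter (· < x)).image (fun y => x - y)

/-- The removal of the bar of length `b` in the row of the part `x` of `μ` (used
for `x ∈ μ.parts` and `b ∈ μ.barLengths x`). If `b < x`, the part `x` is replaced by `x - b`;
if `b = x`, the part `x` is deleted; if `b > x`, so that `b = x + y` with another part `y`, both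
`x` and `y` are deleted. -/
def removeBar (μ : BarPartition) (x b : ℕ) : BarPartition where
  parts :=
    if b < x then insert (x - b) (μ.parts.erase x)
    else if b = x then μ.parts.erase x
    else (μ.parts.erase x).erase (b - x)
  pos := by
    intro z hz
    split_ifs at hz with h1 h2
    · rcases Finset.mem_insert.1 hz with rfl | h
      · omega
      · exact μ.pos z (Finset.mem_of_mem_erase h)
    · exact μ.pos z (Finset.mem_of_mem_erase hz)
    · exact μ.pos z (Finset.mem_of_mem_erase (Finset.mem_of_mem_erase hz))

/-- `ν` arises from `μ` by the removal of one bar of length divisible by `l`. -/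
def RemovesBar (l : ℕ) (μ ν : BarPartition) : Prop :=
  ∃ x ∈ μ.parts, ∃ b ∈ μ.barLengths x, l ∣ b ∧ ν = μ.removeBar x b

/-- `μ` is an `l`-bar-core: it has no bar of length divisible by `l`. -/
def IsBarCore (l : ℕ) (μ : BarPartition) : Prop :=
  ∀ x ∈ μ.parts, ∀ b ∈ μ.barLengths x, ¬ l ∣ b

/-- `γ` is the `l`-bar-core of `μ`: it is obtained from `μ` by removing bars of length
divisible by `l`, one after another, until none is left. -/
def IsBarCoreOf (l : ℕ) (γ μ : BarPartition) : Prop :=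
  Relation.ReflTransGen (RemovesBar l) μ γ ∧ IsBarCore l γ

/-- The `l`-bar-block of bar-partitions of `n` with `l`-bar-core `γ`. -/
def barBlock (l n : ℕ) (γ : BarPartition) : Set BarPartition :=
  {μ | μ.size = n ∧ IsBarCoreOf l γ μ}

/-- The principal `l`-bar-block of bar-partitions of `n`: the `l`-bar-block that contains `(n)`. -/
def principalBarBlock (l n : ℕ) : Set BarPartition :=
  {μ | ∃ γ : BarPartition, single n ∈ barBlock l n γ ∧ μ ∈ barBlock l n γ}

end BarPartition

/-!
For a residue `i` modulo `s`, the charge of a bar-partition at `i` is the number of its parts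
congruent to `i` minus the number of its parts congruent to `-i`. Removing a bar of length
divisible by `s` replaces a part by a congruent one, deletes a part divisible by `s`, or deletes
two parts with opposite residues, so it preserves the charge (`charge_removeBar`). Hence all
members of an `s`-bar-block have the same charges (`charge_eq_of_mem_principalBarBlock`), and in
the principal block the charges are those of `(n)`, where `n ≡ r`: the charge at `r` is `1`, and
the charge at `r - t` is at most `0` because `r - t ≢ r`.

In a `t`-bar-core no part is divisible by `t`, and subtracting `t` from a part larger than `t`
gives a part. If `t ≤ r < s`, every part congruent to `r` is at least `r ≥ t`, and no positive
integer below `t` is congruent to `t - r`. So subtraction of `t` injects the parts congruent to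
`r` into those congruent to `r - t`, and the parts congruent to `t - r` into those congruent to
`-r`. Therefore the charge at `r` of a `t`-bar-core is at most its charge at `r - t`
(`IsBarCore.charge_le`), which is incompatible with the values `1` and `≤ 0`.
-/

namespace BarPartition

/-- The number of parts of `μ` congruent to `i` modulo `s`, minus the number of parts congruent to
`-i`. It vanishes when `2 * i = 0`. -/
def charge (s : ℕ) (i : ZMod s) (μ : BarPartition) : ℤ :=
  ∑ x ∈ μ.parts, ((if (x : ZMod s) = i then 1 else 0) - (if (x : ZMod s) = -i then 1 else 0))

theorem charge_eq_card_sub_card (s : ℕ) (i : ZMod s) (μ : BarPartition) :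
    μ.charge s i = ((μ.parts.filter fun x : ℕ => (x : ZMod s) = i).card : ℤ) -
      (μ.parts.filter fun x : ℕ => (x : ZMod s) = -i).card := by
  simp [charge, Finset.sum_sub_distrib]

theorem charge_single {s n : ℕ} (hn : n ≠ 0) (i : ZMod s) :
    (single n).charge s i =
      (if (n : ZMod s) = i then 1 else 0) - (if (n : ZMod s) = -i then 1 else 0) := by
  have h : (single n).parts = {n} := Finset.erase_eq_of_notMem (by simpa using hn.symm)
  rw [charge, h, Finset.sum_singleton]

theorem charge_removeBar {s : ℕ} (i : ZMod s) {μ : BarPartition} {x b : ℕ} (hx : x ∈ μ.parts)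
    (hb : b ∈ μ.barLengths x) (hsb : s ∣ b) :
    (μ.removeBar x b).charge s i = μ.charge s i := by
  have hb0 : (b : ZMod s) = 0 := (ZMod.natCast_eq_zero_iff b s).2 hsb
  simp only [barLengths, Finset.mem_sdiff, Finset.mem_union, Finset.mem_Icc, Finset.mem_image,
    Finset.mem_filter] at hb
  obtain ⟨hb, hnot⟩ := hb
  unfold charge removeBar
  rw [← Finset.add_sum_erase _ _ hx]
  dsimp only
  rcases lt_trichotomy b x with hbx | rfl | hxb
  · have hxb : x - b ∉ μ.parts.erase x := by
      intro h
      rw [Finset.mem_erase] at h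
      exact hnot ⟨x - b, ⟨h.2, by omega⟩, by omega⟩
    have hcast : ((x - b : ℕ) : ZMod s) = x := by rw [Nat.cast_sub hbx.le, hb0, sub_zero]
    rw [if_pos hbx, Finset.sum_insert hxb, hcast]
  · have hiff : (0 : ZMod s) = -i ↔ 0 = i := by rw [zero_eq_neg, eq_comm]
    simp only [lt_irrefl, if_false, if_true, hb0, hiff, sub_self, zero_add]
  · rw [if_neg hxb.not_gt, if_neg hxb.ne']
    obtain hb | ⟨y, ⟨hy, hyx⟩, rfl⟩ := hb
    · omega
    · rw [Nat.add_sub_cancel_left, ← Finset.add_sum_erase (μ.parts.erase x) _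
        (Finset.mem_erase.2 ⟨hyx.ne, hy⟩)]
      have : (y : ZMod s) = -x := by
        rw [eq_neg_iff_add_eq_zero, add_comm]
        exact_mod_cast hb0
      have hneg : -(x : ZMod s) = i ↔ (x : ZMod s) = -i := neg_eq_iff_eq_neg
      simp only [this, neg_inj, hneg]
      ring

theorem IsBarCoreOf.charge_eq {s : ℕ} (i : ZMod s) {γ μ : BarPartition}
    (h : IsBarCoreOf s γ μ) : γ.charge s i = μ.charge s i := by
  obtain ⟨h, -⟩ := h
  induction h with
  | refl => rfl
  | tail _ hr ih =>
    obtain ⟨x, hx, b, hb, hsb, rfl⟩ := hr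
    exact (charge_removeBar i hx hb hsb).trans ih

theorem charge_eq_of_mem_principalBarBlock {s n : ℕ} (i : ZMod s) {μ : BarPartition}
    (h : μ ∈ principalBarBlock s n) : μ.charge s i = (single n).charge s i := by
  obtain ⟨γ, hn, hμ⟩ := h
  exact (hμ.2.charge_eq i).symm.trans (hn.2.charge_eq i)

theorem IsBarCore.not_dvd {t : ℕ} {μ : BarPartition} (h : IsBarCore t μ) {x : ℕ}
    (hx : x ∈ μ.parts) : ¬ t ∣ x := by
  have := μ.pos x hx
  refine h x hx x ?_
  simp only [barLengths, Finset.mem_sdiff, Finset.mem_union, Finset.mem_Icc, Finset.mem_image,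
    Finset.mem_filter, not_exists, not_and]
  refine ⟨Or.inl ⟨this, le_rfl⟩, fun y hy => ?_⟩
  have := μ.pos y hy.1
  omega

theorem IsBarCore.sub_mem {t : ℕ} (ht : 0 < t) {μ : BarPartition} (h : IsBarCore t μ) {x : ℕ}
    (hx : x ∈ μ.parts) (htx : t < x) : x - t ∈ μ.parts := by
  by_contra hnot
  refine h x hx t ?_ dvd_rfl
  simp only [barLengths, Finset.mem_sdiff, Finset.mem_union, Finset.mem_Icc, Finset.mem_image,
    Finset.mem_filter, not_exists, not_and]
  refine ⟨Or.inl ⟨ht, htx.le⟩, fun y hy hyt => hnot ?_⟩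
  have : x - t = y := by omega
  exact this ▸ hy.1

/-- In a `t`-bar-core, subtraction of `t` injects the parts congruent to `i` into those congruent
to `i - t`, provided that no positive integer less than `t` is congruent to `i`. -/
theorem IsBarCore.card_filter_le {s t : ℕ} (ht : 0 < t) {μ : BarPartition} (h : IsBarCore t μ)
    {i j : ZMod s} (hij : i - t = j) (hi : ∀ x : ℕ, 0 < x → (x : ZMod s) = i → t ≤ x) :
    (μ.parts.filter fun x : ℕ => (x : ZMod s) = i).card ≤
      (μ.parts.filter fun x : ℕ => (x : ZMod s) = j).card := by
  have key : ∀ x ∈ μ.parts, (x : ZMod s) = i → t < x := fun x hx hxi =>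
    (hi x (μ.pos x hx) hxi).lt_of_ne fun h' => h.not_dvd hx (h' ▸ dvd_rfl)
  refine Finset.card_le_card_of_injOn (fun x => x - t) ?_ ?_
  · intro x hx
    obtain ⟨hx, hxi⟩ := Finset.mem_filter.1 hx
    have htx := key x hx hxi
    refine Finset.mem_filter.2 ⟨h.sub_mem ht hx htx, ?_⟩
    rw [Nat.cast_sub htx.le, hxi, hij]
  · intro x hx y hy hxy
    obtain ⟨hx, hxi⟩ := Finset.mem_filter.1 hx
    obtain ⟨hy, hyi⟩ := Finset.mem_filter.1 hy
    have := key x hx hxi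
    have := key y hy hyi
    dsimp only at hxy
    omega

theorem IsBarCore.charge_le {r s t : ℕ} (ht : 0 < t) (hrs : r < s) (htr : t ≤ r)
    {μ : BarPartition} (h : IsBarCore t μ) :
    μ.charge s r ≤ μ.charge s ((r : ZMod s) - t) := by
  have h1 := h.card_filter_le ht (i := (r : ZMod s)) rfl fun x _ hx => by
    rw [ZMod.natCast_eq_natCast_iff', Nat.mod_eq_of_lt hrs] at hx
    have := Nat.mod_le x s
    omega
  have h2 := h.card_filter_le ht (i := -((r : ZMod s) - (t : ZMod s))) (j := -(r : ZMod s)) (by ring)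
    fun x hx0 hx => by
      by_contra! hxt
      -- `x + (r - t)` is divisible by `s` but lies strictly between `0` and `s`.
      have : ((x + (r - t) : ℕ) : ZMod s) = 0 := by
        rw [Nat.cast_add, Nat.cast_sub htr, hx]
        ring
      have := Nat.le_of_dvd (by omega) ((ZMod.natCast_eq_zero_iff _ _).1 this)
      omega
  rw [charge_eq_card_sub_card, charge_eq_card_sub_card]
  omega

end BarPartition

theorem mainTheorem4 (r s t a n : ℕ) (hr : 0 < r) (hs : 0 < s) (ht : 0 < t)
    (hs_odd : Odd s) (ht_odd : Odd t) (hrs : r < s) (htr : t ≤ r) (hn : n = a * s + r) :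
    ∀ μ ∈ BarPartition.principalBarBlock s n, ¬ BarPartition.IsBarCore t μ := by
  intro μ hμ hcore
  have hle := hcore.charge_le ht hrs htr
  have hnr : (n : ZMod s) = r := by simp [hn]
  have hr_neg : (r : ZMod s) ≠ -r := by
    intro h
    rw [eq_neg_iff_add_eq_zero, ← two_mul] at h
    have hdvd : s ∣ 2 * r := (ZMod.natCast_eq_zero_iff _ _).1 (by exact_mod_cast h)
    have := Nat.le_of_dvd hr (hs_odd.coprime_two_right.dvd_of_dvd_mul_left hdvd)
    omega
  have hr_sub : (r : ZMod s) ≠ r - t := by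
    intro h
    have ht0 : (t : ZMod s) = 0 := sub_eq_self.1 h.symm
    have := Nat.le_of_dvd ht ((ZMod.natCast_eq_zero_iff _ _).1 ht0)
    omega
  rw [BarPartition.charge_eq_of_mem_principalBarBlock _ hμ,
    BarPartition.charge_eq_of_mem_principalBarBlock _ hμ,
    BarPartition.charge_single (by omega), BarPartition.charge_single (by omega), hnr,
    if_pos rfl, if_neg hr_neg, if_neg hr_sub] at hle
  split_ifs at hle <;> omega
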